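/- Let $I=(a,b)$ with real numbers $a<b$. For $u\in L^1(I)$ let $$J(u)=\sup\Big\{\int_a^b u(x)\,\xi'(x)\,dx : \xi\in C^1_0(I),\ \|\xi\|_\infty\le 1\Big\}\in[0,\infty],$$ where $C_0^1(I)$ is the space of continuously differentiable functions with compact support in $I$, and let $BV(I)=\{u\in L^1(I): J(u)<\infty\}$ (functions in $BV(I)$ belong to $L^2(I)$). For $f\in L^2(I)$ and $\lambda>0$ the ROF functional $$E_\lambda(f;u)=\lambda J(u)+\tfrac12\|f-u\|_{L^2(I)}^2,\qquad u\in BV(I),$$ has exactly one minimizer in $BV(I)$. Denote it by $f_\lambda$ (ROF denoising of $f$ with parameter $\lambda$), and put $f_0=f$. Then, for every $f\in L^2(I)$, $$(f_\lambda)_\mu=f_{\lambda+\mu}\qquad\text{for all real }\lambda,\mu\ge 0.$$ -/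

import Mathlib

open MeasureTheory

noncomputable section

namespace ROF

/-- The Hilbert space `L²(I)` of (classes of) real functions on the interval `I = (a, b)`. -/
abbrev L2 (a b : ℝ) : Type := Lp ℝ 2 (volume.restrict (Set.Ioo a b))

/-- Continuously differentiable functions with compact support contained in the open interval
`I = (a, b)`, extended by zero to the whole line, with sup-norm at most one. -/
structure IsTestFunction (a b : ℝ) (ξ : ℝ → ℝ) : Prop where
  contDiff : ContDiff ℝ 1 ξ
  hasCompactSupport : HasCompactSupport ξ
  tsupport_subset : tsupport ξ ⊆ Set.Ioo a b
  abs_le_one : ∀ x, |ξ x| ≤ 1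

/-- The total variation `J(u) = sup { ∫ u ξ' : ξ ∈ C¹₀(I), ‖ξ‖_∞ ≤ 1 }`, an extended real. -/
def totalVariation (a b : ℝ) (u : ℝ → ℝ) : EReal :=
  ⨆ ξ : {ξ : ℝ → ℝ // IsTestFunction a b ξ},
    ((∫ x in Set.Ioo a b, u x * deriv ξ.1 x : ℝ) : EReal)

/-- `u ∈ BV(I)`: `u` is integrable on `I` and has finite total variation. -/
def IsBV (a b : ℝ) (u : ℝ → ℝ) : Prop :=
  IntegrableOn u (Set.Ioo a b) ∧ totalVariation a b u < ⊤

/-- The functional `E_lam(f; u) = lam * J(u) + ‖f - u‖² / 2`, used for `u` of bounded variation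
(where `J(u)` is a non-negative real number). -/
def energy (a b lam : ℝ) (f u : L2 a b) : ℝ :=
  lam * (totalVariation a b u).toReal + (1 / 2) * ‖f - u‖ ^ 2

/-- `u` minimizes `E_lam(f; ·)` over the functions of bounded variation on `I`. -/
def IsMinimizer (a b lam : ℝ) (f u : L2 a b) : Prop :=
  IsBV a b u ∧ ∀ v : L2 a b, IsBV a b v → energy a b lam f u ≤ energy a b lam f v

/-- ROF denoising `f ↦ f_lam`: the minimizer of `E_lam(f; ·)` for `lam > 0`, and `f` itself
for `lam = 0`. -/
def denoise (a b lam : ℝ) (f : L2 a b) : L2 a b :=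
  if lam = 0 then f else Classical.epsilon (IsMinimizer a b lam f)

end ROF

end

open MeasureTheory Filter Topology

namespace ROF

/-! `J` is the support function of the closed convex set `K = dualBall a b`. Hence `u = f_lam`
exactly when `f = u + lam • p` with `p ∈ K` and `⟨u, ·⟩` maximal on `K` at `p`: `lam • p` is the
projection of `f` onto `lam • K` (`exists_moreau`, `denoise_eq_of_isMax`).

Denoise twice: `f = u + lam • p`, `u = v + mu • q`. If `⟨v, ·⟩` is maximal on `K` at `p` as well as
at `q`, it is maximal at their weighted mean, and `f = v + (lam + mu) • (mean)` identifies `v` as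
`f_(lam + mu)`. So all rests on `⟨v, q - p⟩ ≤ 0` (`inner_sub_nonpos_of_isMax`).

Let `P`, `Q` be the primitives of `p`, `q`, bounded by one, and `G` the derivative of `(Q - P) Q ^
(m + 1)`, `m + 1` even. The factor `Q ^ (m + 1)` approximates the indicator of the contact set `|Q|
= 1`. Maximality of `v + mu • q` at `p` gives `⟨v + mu • q, G⟩ ≤ 0`; maximality of `v` at `q` gives
`⟨v, q - p⟩ ≤ ⟨v, G⟩`. Thus `⟨v, q - p⟩ ≤ -mu ⟨q, G⟩`, whose upper limit is at most zero because `q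
= 0` a.e. on the contact set. -/

variable {a b : ℝ}

/-! ### Convex duality and the Moreau decomposition -/

/-- The closure in `L²(I)` of the derivatives of test functions; the total variation is its
support function. -/
def dualBall (a b : ℝ) : Set (L2 a b) :=
  closure {g | ∃ ξ, IsTestFunction a b ξ ∧ g =ᵐ[volume.restrict (Set.Ioo a b)] deriv ξ}

theorem IsTestFunction.continuous_deriv {ξ : ℝ → ℝ} (h : IsTestFunction a b ξ) :
    Continuous (deriv ξ) := h.contDiff.continuous_deriv le_rfl

theorem IsTestFunction.differentiableAt {ξ : ℝ → ℝ} (h : IsTestFunction a b ξ) (x : ℝ) :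
    DifferentiableAt ℝ ξ x := h.contDiff.differentiable one_ne_zero x

theorem IsTestFunction.memLp_deriv {ξ : ℝ → ℝ} (h : IsTestFunction a b ξ) :
    MemLp (deriv ξ) 2 (volume.restrict (Set.Ioo a b)) :=
  h.continuous_deriv.memLp_of_hasCompactSupport h.hasCompactSupport.deriv

theorem IsTestFunction.toLp_mem {ξ : ℝ → ℝ} (h : IsTestFunction a b ξ) :
    h.memLp_deriv.toLp ∈ dualBall a b :=
  subset_closure ⟨ξ, h, h.memLp_deriv.coeFn_toLp⟩

theorem isTestFunction_zero : IsTestFunction a b 0 where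
  contDiff := contDiff_const
  hasCompactSupport := HasCompactSupport.zero
  tsupport_subset := by simp [tsupport]
  abs_le_one := by simp

/-- A `C¹` function bounded by one that vanishes wherever two test functions do is a test
function. -/
theorem IsTestFunction.of_pair {ξ η ζ : ℝ → ℝ} (hξ : IsTestFunction a b ξ)
    (hη : IsTestFunction a b η) (hζ : ContDiff ℝ 1 ζ) (h1 : ∀ x, |ζ x| ≤ 1)
    (h0 : ∀ x, ξ x = 0 → η x = 0 → ζ x = 0) : IsTestFunction a b ζ := by
  have hs : tsupport ζ ⊆ tsupport ξ ∪ tsupport η := by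
    refine closure_minimal (fun x hx => ?_) ((isClosed_tsupport _).union (isClosed_tsupport _))
    by_contra hc
    simp only [Set.mem_union, not_or] at hc
    exact hx (h0 x (image_eq_zero_of_notMem_tsupport hc.1)
      (image_eq_zero_of_notMem_tsupport hc.2))
  exact ⟨hζ, (hξ.hasCompactSupport.isCompact.union hη.hasCompactSupport.isCompact).of_isClosed_subset
    (isClosed_tsupport _) hs, hs.trans (Set.union_subset hξ.tsupport_subset hη.tsupport_subset), h1⟩

theorem convex_dualBall : Convex ℝ (dualBall a b) := by
  refine Convex.closure ?_
  rintro f ⟨ξ, hξ, hf⟩ g ⟨η, hη, hg⟩ s t hs ht hst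
  refine ⟨fun x => s * ξ x + t * η x, hξ.of_pair hη ?_ (fun x => ?_) ?_, ?_⟩
  · exact (contDiff_const.mul hξ.contDiff).add (contDiff_const.mul hη.contDiff)
  · have h1 := abs_le.1 (hξ.abs_le_one x)
    have h2 := abs_le.1 (hη.abs_le_one x)
    rw [abs_le]
    constructor <;> nlinarith
  · intro x h1 h2
    simp [h1, h2]
  · filter_upwards [hf, hg, Lp.coeFn_add (s • f) (t • g), Lp.coeFn_smul s f, Lp.coeFn_smul t g]
      with x h1 h2 h3 h4 h5
    have := ((hξ.differentiableAt x).hasDerivAt.const_mul s).add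
      ((hη.differentiableAt x).hasDerivAt.const_mul t)
    rw [h3, Pi.add_apply, h4, h5]
    simp only [Pi.smul_apply, h1, h2, smul_eq_mul]
    exact this.deriv.symm

theorem dualBall_nonempty : (dualBall a b).Nonempty := ⟨_, isTestFunction_zero.toLp_mem⟩

theorem inner_eq_integral_mul (u g : L2 a b) {h : ℝ → ℝ}
    (hg : g =ᵐ[volume.restrict (Set.Ioo a b)] h) :
    inner ℝ u g = ∫ x in Set.Ioo a b, u x * h x := by
  rw [L2.inner_def]
  refine integral_congr_ae ?_
  filter_upwards [hg] with x hx
  simp [hx, mul_comm]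

/-- If `p` maximizes `⟨u, ·⟩` over the dual ball, then `J(u) = ⟨u, p⟩`. -/
theorem totalVariation_eq_inner {u p : L2 a b} (hp : p ∈ dualBall a b)
    (hu : ∀ r ∈ dualBall a b, inner ℝ u (r - p) ≤ 0) :
    totalVariation a b u = (inner ℝ u p : ℝ) := by
  apply le_antisymm
  · refine iSup_le fun ξ => ?_
    have := hu _ ξ.2.toLp_mem
    rw [inner_sub_right, inner_eq_integral_mul u _ ξ.2.memLp_deriv.coeFn_toLp] at this
    exact_mod_cast sub_nonpos.1 this
  · have hcl : IsClosed {g : L2 a b | ((inner ℝ u g : ℝ) : EReal) ≤ totalVariation a b u} :=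
      isClosed_le (continuous_coe_real_ereal.comp (by fun_prop)) continuous_const
    refine closure_minimal ?_ hcl hp
    rintro g ⟨ξ, hξ, hg⟩
    rw [Set.mem_ofPred_eq, inner_eq_integral_mul u g hg]
    exact le_iSup (fun ξ : {ξ : ℝ → ℝ // IsTestFunction a b ξ} =>
      ((∫ x in Set.Ioo a b, u x * deriv ξ.1 x : ℝ) : EReal)) ⟨ξ, hξ⟩

theorem inner_le_totalVariation {v p : L2 a b} (hp : p ∈ dualBall a b) (hv : IsBV a b v) :
    inner ℝ v p ≤ (totalVariation a b v).toReal := by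
  have hcl : IsClosed {g : L2 a b | inner ℝ v g ≤ (totalVariation a b v).toReal} :=
    isClosed_le (by fun_prop) continuous_const
  refine closure_minimal ?_ hcl hp
  rintro g ⟨ξ, hξ, hg⟩
  rw [Set.mem_ofPred_eq, inner_eq_integral_mul v g hg]
  have := le_iSup (fun ξ : {ξ : ℝ → ℝ // IsTestFunction a b ξ} =>
      ((∫ x in Set.Ioo a b, v x * deriv ξ.1 x : ℝ) : EReal)) ⟨ξ, hξ⟩
  -- Finiteness of `J(v)` is essential, since `toReal` sends `⊤` to zero.
  have h2 : EReal.toReal _ ≤ (totalVariation a b v).toReal :=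
    EReal.toReal_le_toReal this (EReal.coe_ne_bot _) hv.2.ne
  rwa [EReal.toReal_coe] at h2

theorem isBV_of_isMax {u p : L2 a b} (hp : p ∈ dualBall a b)
    (hu : ∀ r ∈ dualBall a b, inner ℝ u (r - p) ≤ 0) : IsBV a b u := by
  refine ⟨(Lp.memLp u).integrable one_le_two, ?_⟩
  rw [totalVariation_eq_inner hp hu]
  exact EReal.coe_lt_top _

/-- Expand the square of `f - v = lam • p + (u - v)` and use `J(u) = ⟨u, p⟩`, `⟨v, p⟩ ≤ J(v)`. The
quadratic surplus yields minimality and uniqueness together. -/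
theorem energy_add_le {lam : ℝ} (hlam : 0 ≤ lam) {f u p v : L2 a b} (hp : p ∈ dualBall a b)
    (hu : ∀ r ∈ dualBall a b, inner ℝ u (r - p) ≤ 0) (hf : f = u + lam • p) (hv : IsBV a b v) :
    energy a b lam f u + (1 / 2) * ‖u - v‖ ^ 2 ≤ energy a b lam f v := by
  have h1 := mul_le_mul_of_nonneg_left (inner_le_totalVariation hp hv) hlam
  have e1 : f - u = lam • p := by rw [hf]; abel
  have e2 : f - v = lam • p + (u - v) := by rw [hf]; abel
  unfold energy
  rw [totalVariation_eq_inner hp hu, EReal.toReal_coe, e1, e2, norm_add_sq_real,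
    real_inner_smul_left, inner_sub_right, real_inner_comm u p, real_inner_comm v p]
  nlinarith

theorem isMinimizer_of_isMax {lam : ℝ} (hlam : 0 ≤ lam) {f u p : L2 a b} (hp : p ∈ dualBall a b)
    (hu : ∀ r ∈ dualBall a b, inner ℝ u (r - p) ≤ 0) (hf : f = u + lam • p) :
    IsMinimizer a b lam f u := by
  refine ⟨isBV_of_isMax hp hu, fun v hv => ?_⟩
  have := energy_add_le hlam hp hu hf hv
  nlinarith [sq_nonneg ‖u - v‖]

theorem IsMinimizer.eq_of_isMax {lam : ℝ} (hlam : 0 ≤ lam) {f u p v : L2 a b}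
    (hp : p ∈ dualBall a b) (hu : ∀ r ∈ dualBall a b, inner ℝ u (r - p) ≤ 0)
    (hf : f = u + lam • p) (hv : IsMinimizer a b lam f v) : v = u := by
  have h1 := energy_add_le hlam hp hu hf hv.1
  have h2 := hv.2 u (isBV_of_isMax hp hu)
  have h3 : ‖u - v‖ = 0 := by
    have : ‖u - v‖ ^ 2 = 0 := le_antisymm (by linarith) (sq_nonneg _)
    exact pow_eq_zero_iff two_ne_zero |>.1 this
  exact (sub_eq_zero.1 (norm_eq_zero.1 h3)).symm

theorem denoise_eq_of_isMax {lam : ℝ} (hlam : 0 < lam) {f u p : L2 a b}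
    (hp : p ∈ dualBall a b) (hu : ∀ r ∈ dualBall a b, inner ℝ u (r - p) ≤ 0)
    (hf : f = u + lam • p) : denoise a b lam f = u := by
  rw [denoise, if_neg hlam.ne']
  exact (Classical.epsilon_spec (p := IsMinimizer a b lam f)
    ⟨u, isMinimizer_of_isMax hlam.le hp hu hf⟩).eq_of_isMax hlam.le hp hu hf

/-- Moreau decomposition of `f` with respect to the dilated dual ball. -/
theorem exists_moreau {lam : ℝ} (hlam : 0 < lam) (f : L2 a b) :
    ∃ p ∈ dualBall a b, (∀ r ∈ dualBall a b, inner ℝ (denoise a b lam f) (r - p) ≤ 0) ∧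
      f = denoise a b lam f + lam • p := by
  obtain ⟨p, hp, hmin⟩ := exists_norm_eq_iInf_of_complete_convex (dualBall_nonempty (a := a) (b := b))
    isClosed_closure.isComplete convex_dualBall (lam⁻¹ • f)
  rw [norm_eq_iInf_iff_real_inner_le_zero convex_dualBall hp] at hmin
  have hu : ∀ r ∈ dualBall a b, inner ℝ (f - lam • p) (r - p) ≤ 0 := by
    intro r hr
    have e : f - lam • p = lam • (lam⁻¹ • f - p) := by
      rw [smul_sub, smul_inv_smul₀ hlam.ne']
    rw [e, real_inner_smul_left]
    exact mul_nonpos_of_nonneg_of_nonpos hlam.le (hmin r hr)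
  have hf : f = (f - lam • p) + lam • p := by abel
  rw [denoise_eq_of_isMax hlam hp hu hf]
  exact ⟨p, hp, hu, hf⟩

end ROF
-- Multiplication of `L²` functions by bounded functions
section BoundedMultiplication

variable {α : Type*} [MeasurableSpace α] {μ : Measure α}

theorem MeasureTheory.Lp.memLp_bdd_mul {c : α → ℝ} {C : ℝ} (hc : AEStronglyMeasurable c μ)
    (hC : ∀ᵐ x ∂μ, |c x| ≤ C) (g : Lp ℝ 2 μ) : MemLp (fun x => c x * g x) 2 μ := by
  refine (Lp.memLp g).of_le_mul (c := C) (hc.mul (Lp.aestronglyMeasurable g)) ?_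
  filter_upwards [hC] with x hx
  rw [norm_mul]
  exact mul_le_mul_of_nonneg_right hx (norm_nonneg _)

open Classical in
/-- The product `c g` as an element of `L²`, for a bounded measurable function `c`
(and zero when `c g` is not square integrable). -/
noncomputable def MeasureTheory.Lp.bddMul (c : α → ℝ) (g : Lp ℝ 2 μ) : Lp ℝ 2 μ :=
  if h : MemLp (fun x => c x * g x) 2 μ then h.toLp else 0

theorem MeasureTheory.Lp.coeFn_bddMul {c : α → ℝ} {C : ℝ} (hc : AEStronglyMeasurable c μ)
    (hC : ∀ᵐ x ∂μ, |c x| ≤ C) (g : Lp ℝ 2 μ) : Lp.bddMul c g =ᵐ[μ] fun x => c x * g x := by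
  rw [Lp.bddMul, dif_pos (Lp.memLp_bdd_mul hc hC g)]
  exact MemLp.coeFn_toLp _

/-- Split `c k * g k = c k * g₀ + c k * (g k - g₀)`: dominated convergence handles the first term,
the uniform bound `C` the second. -/
theorem MeasureTheory.Lp.tendsto_inner_bddMul (w : Lp ℝ 2 μ) {g : ℕ → Lp ℝ 2 μ} {g₀ : Lp ℝ 2 μ}
    (hg : Tendsto g atTop (𝓝 g₀)) {c : ℕ → α → ℝ} {c₀ : α → ℝ} {C : ℝ}
    (hc : ∀ k, AEStronglyMeasurable (c k) μ) (hC : ∀ k, ∀ᵐ x ∂μ, |c k x| ≤ C)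
    (hlim : ∀ᵐ x ∂μ, Tendsto (fun k => c k x) atTop (𝓝 (c₀ x))) :
    Tendsto (fun k => inner ℝ w (Lp.bddMul (c k) (g k))) atTop
      (𝓝 (inner ℝ w (Lp.bddMul c₀ g₀))) := by
  have hc₀ : AEStronglyMeasurable c₀ μ := aestronglyMeasurable_of_tendsto_ae atTop hc hlim
  have hC₀ : ∀ᵐ x ∂μ, |c₀ x| ≤ C := by
    filter_upwards [hlim, ae_all_iff.2 hC] with x h1 h2
    exact le_of_tendsto' h1.abs h2
  have h1 : Tendsto (fun k => inner ℝ w (Lp.bddMul (c k) g₀)) atTop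
      (𝓝 (inner ℝ w (Lp.bddMul c₀ g₀))) := by
    simp only [L2.inner_def]
    refine tendsto_integral_of_dominated_convergence (fun x => C * (|w x| * |g₀ x|))
      (fun k => ((Lp.aestronglyMeasurable w).inner (Lp.aestronglyMeasurable _))) ?_ ?_ ?_
    · exact (((Lp.memLp w).abs.integrable_mul (Lp.memLp g₀).abs)).const_mul C
    · intro k
      filter_upwards [Lp.coeFn_bddMul (hc k) (hC k) g₀, hC k] with x hx hx2
      rw [hx]
      simp only [RCLike.inner_apply, conj_trivial, norm_mul, Real.norm_eq_abs]
      have := mul_le_mul_of_nonneg_right hx2 (mul_nonneg (abs_nonneg (w x)) (abs_nonneg (g₀ x)))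
      nlinarith
    · filter_upwards [ae_all_iff.2 fun k => Lp.coeFn_bddMul (hc k) (hC k) g₀,
        Lp.coeFn_bddMul hc₀ hC₀ g₀, hlim] with x hx hx2 hx3
      simp only [hx, hx2, RCLike.inner_apply, conj_trivial]
      exact (hx3.mul_const _).mul_const _
  have h2 : Tendsto (fun k => inner ℝ w (Lp.bddMul (c k) (g k) - Lp.bddMul (c k) g₀)) atTop
      (𝓝 0) := by
    have hn : Tendsto (fun k => ‖w‖ * (C * ‖g k - g₀‖)) atTop (𝓝 0) := by
      have := ((tendsto_iff_norm_sub_tendsto_zero.1 hg).const_mul C).const_mul ‖w‖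
      simpa using this
    refine squeeze_zero_norm (fun k => ?_) hn
    refine (norm_inner_le_norm _ _).trans (mul_le_mul_of_nonneg_left ?_ (norm_nonneg _))
    refine Lp.norm_le_mul_norm_of_ae_le_mul ?_
    filter_upwards [Lp.coeFn_bddMul (hc k) (hC k) g₀, Lp.coeFn_bddMul (hc k) (hC k) (g k), hC k,
      Lp.coeFn_sub (Lp.bddMul (c k) (g k)) (Lp.bddMul (c k) g₀), Lp.coeFn_sub (g k) g₀]
      with x e1 e2 e3 e4 e5
    rw [e4, e5, Pi.sub_apply, Pi.sub_apply, e1, e2, ← mul_sub, norm_mul]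
    exact mul_le_mul_of_nonneg_right e3 (norm_nonneg _)
  have h3 := h2.add h1
  rw [zero_add] at h3
  refine h3.congr fun k => ?_
  rw [inner_sub_right, sub_add_cancel]

end BoundedMultiplication

/-! ### Primitives of elements of the dual ball -/

namespace ROF

variable {a b : ℝ}

/-- `ξ k` are test functions whose derivatives `g k` converge to `p` in `L²(I)`, and which converge
pointwise to `P` on `I`. -/
structure IsApprox (a b : ℝ) (p : L2 a b) (P : ℝ → ℝ) (ξ : ℕ → ℝ → ℝ) (g : ℕ → L2 a b) :
    Prop where
  test : ∀ k, IsTestFunction a b (ξ k)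
  ae_eq_deriv : ∀ k, g k =ᵐ[volume.restrict (Set.Ioo a b)] deriv (ξ k)
  tendsto : Tendsto g atTop (𝓝 p)
  tendsto_apply : ∀ x ∈ Set.Ioo a b, Tendsto (fun k => ξ k x) atTop (𝓝 (P x))

theorem setIntegral_tendsto {g : ℕ → L2 a b} {p : L2 a b} (hg : Tendsto g atTop (𝓝 p))
    {s : Set ℝ} (hs : MeasurableSet s) :
    Tendsto (fun k => ∫ x in s, g k x ∂(volume.restrict (Set.Ioo a b))) atTop
      (𝓝 (∫ x in s, p x ∂(volume.restrict (Set.Ioo a b)))) := by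
  have hm : (volume.restrict (Set.Ioo a b)) s ≠ ⊤ := measure_ne_top _ _
  simp only [← L2.inner_indicatorConstLp_one (𝕜 := ℝ) hs hm]
  exact tendsto_const_nhds.inner hg

theorem intervalIntegral_eq (p : L2 a b) {x : ℝ} (hx : x ∈ Set.Ioo a b) :
    ∫ t in a..x, p t = ∫ t in Set.Ioc a x, p t ∂(volume.restrict (Set.Ioo a b)) := by
  rw [intervalIntegral.integral_of_le hx.1.le, Measure.restrict_restrict measurableSet_Ioc,
    Set.inter_eq_left.2]
  exact fun t ht => ⟨ht.1, ht.2.trans_lt hx.2⟩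

theorem IsTestFunction.eq_integral {ξ : ℝ → ℝ} (h : IsTestFunction a b ξ) {g : L2 a b}
    (hg : g =ᵐ[volume.restrict (Set.Ioo a b)] deriv ξ) {x : ℝ} (hx : x ∈ Set.Ioo a b) :
    ξ x = ∫ t in a..x, g t := by
  have h0 : ξ a = 0 := image_eq_zero_of_notMem_tsupport
    fun hc => lt_irrefl _ (h.tsupport_subset hc).1
  have h1 : ∫ t in a..x, deriv ξ t = ξ x - ξ a :=
    intervalIntegral.integral_deriv_eq_sub (fun t _ => h.differentiableAt t)
      (h.continuous_deriv.intervalIntegrable _ _)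
  rw [h0, sub_zero] at h1
  rw [← h1, intervalIntegral_eq g hx, intervalIntegral.integral_of_le hx.1.le,
    setIntegral_congr_ae (g := deriv ξ) measurableSet_Ioc (hg.mono fun t ht _ => ht),
    Measure.restrict_restrict measurableSet_Ioc, Set.inter_eq_left.2]
  exact fun t ht => ⟨ht.1, ht.2.trans_lt hx.2⟩

/-- Evaluating a primitive at `x` is pairing its derivative with an indicator, so `L²` convergence
of derivatives forces pointwise convergence of primitives. -/
theorem exists_isApprox {p : L2 a b} (hp : p ∈ dualBall a b) :
    ∃ ξ g, IsApprox a b p (fun x => ∫ t in a..x, p t) ξ g := by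
  obtain ⟨g, hg, hlim⟩ := mem_closure_iff_seq_limit.1 hp
  choose ξ hξ hd using hg
  refine ⟨ξ, g, hξ, hd, hlim, fun x hx => ?_⟩
  simp only [(hξ _).eq_integral (hd _) hx, intervalIntegral_eq _ hx]
  exact setIntegral_tendsto hlim measurableSet_Ioc

namespace IsApprox

variable {p q : L2 a b} {P Q : ℝ → ℝ} {ξ η : ℕ → ℝ → ℝ} {g h : ℕ → L2 a b}

theorem abs_le_one (hp : IsApprox a b p P ξ g) {x : ℝ} (hx : x ∈ Set.Ioo a b) : |P x| ≤ 1 :=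
  le_of_tendsto' (hp.tendsto_apply x hx).abs fun k => (hp.test k).abs_le_one x

theorem aestronglyMeasurable (hp : IsApprox a b p P ξ g) :
    AEStronglyMeasurable P (volume.restrict (Set.Ioo a b)) :=
  aestronglyMeasurable_of_tendsto_ae atTop
    (fun k => (hp.test k).contDiff.continuous.aestronglyMeasurable)
    (ae_restrict_of_forall_mem measurableSet_Ioo hp.tendsto_apply)

theorem eq_integral (hp : IsApprox a b p P ξ g) {x : ℝ} (hx : x ∈ Set.Ioo a b) :
    P x = ∫ t in a..x, p t := by
  refine tendsto_nhds_unique (hp.tendsto_apply x hx) ?_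
  simp only [(hp.test _).eq_integral (hp.ae_eq_deriv _) hx, intervalIntegral_eq _ hx]
  exact setIntegral_tendsto hp.tendsto measurableSet_Ioc

/-- The derivative vanishes almost everywhere where the obstacle is touched, since there the
primitive has a local extremum. -/
theorem ae_eq_zero (hp : IsApprox a b p P ξ g) :
    ∀ᵐ x ∂(volume.restrict (Set.Ioo a b)), |P x| = 1 → p x = 0 := by
  rcases le_or_gt b a with hab | hab
  · simp [Set.Ioo_eq_empty hab.not_gt]
  have hi : IntervalIntegrable p volume a b := by
    rw [intervalIntegrable_iff_integrableOn_Ioo_of_le hab.le]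
    exact (Lp.memLp p).integrable one_le_two
  refine (ae_restrict_iff' measurableSet_Ioo).2 ?_
  filter_upwards [hi.ae_hasDerivAt_integral] with x hx hxI hP
  have hn := Ioo_mem_nhds hxI.1 hxI.2
  have hd : HasDerivAt P (p x) x := by
    refine (hx ?_ a Set.left_mem_uIcc).congr_of_eventuallyEq ?_
    · rw [Set.uIcc_of_le hab.le]
      exact Set.Ioo_subset_Icc_self hxI
    · filter_upwards [hn] with y hy
      exact hp.eq_integral hy
  rcases eq_or_eq_neg_of_abs_eq hP with h1 | h1
  · refine IsLocalMax.hasDerivAt_eq_zero (f := P) ?_ hd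
    filter_upwards [hn] with y hy
    rw [h1]
    exact (abs_le.1 (hp.abs_le_one hy)).2
  · refine IsLocalMin.hasDerivAt_eq_zero (f := P) ?_ hd
    filter_upwards [hn] with y hy
    rw [h1]
    exact (abs_le.1 (hp.abs_le_one hy)).1

end IsApprox

/-! ### Perturbations by the weighted gap -/

/-- The derivative of `(Q - P) Q ^ (m + 1)` when `P' = p` and `Q' = q`. -/
noncomputable def gapDeriv (m : ℕ) (P Q : ℝ → ℝ) (p q : L2 a b) : L2 a b :=
  Lp.bddMul (fun x => Q x ^ (m + 1)) (q - p) +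
    Lp.bddMul (fun x => (Q x - P x) * ((m + 1) * Q x ^ m)) q

theorem abs_gap_le {s t : ℝ} (m : ℕ) (hs : |s| ≤ 1) (ht : |t| ≤ 1) :
    |(t - s) * ((m + 1) * t ^ m)| ≤ 2 * (m + 1) := by
  have h1 : |t - s| ≤ 2 := (abs_sub _ _).trans (by linarith)
  have h2 : |t ^ m| ≤ 1 := by
    rw [abs_pow]
    exact pow_le_one₀ (abs_nonneg _) ht
  have h3 : |(m : ℝ) + 1| = m + 1 := abs_of_nonneg (by positivity)
  rw [abs_mul, abs_mul, h3]
  have h4 : ((m : ℝ) + 1) * |t ^ m| ≤ m + 1 := mul_le_of_le_one_right (by positivity) h2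
  exact mul_le_mul h1 h4 (by positivity) zero_le_two

theorem coeFn_gapDeriv (m : ℕ) {P Q : ℝ → ℝ} (p q : L2 a b)
    (hP : AEStronglyMeasurable P (volume.restrict (Set.Ioo a b)))
    (hQ : AEStronglyMeasurable Q (volume.restrict (Set.Ioo a b)))
    (hP1 : ∀ x ∈ Set.Ioo a b, |P x| ≤ 1) (hQ1 : ∀ x ∈ Set.Ioo a b, |Q x| ≤ 1) :
    gapDeriv m P Q p q =ᵐ[volume.restrict (Set.Ioo a b)] fun x =>
      Q x ^ (m + 1) * (q x - p x) + (Q x - P x) * ((m + 1) * Q x ^ m) * q x := by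
  have h1 : ∀ᵐ x ∂(volume.restrict (Set.Ioo a b)), |Q x ^ (m + 1)| ≤ 1 := by
    refine ae_restrict_of_forall_mem measurableSet_Ioo fun x hx => ?_
    rw [abs_pow]
    exact pow_le_one₀ (abs_nonneg _) (hQ1 x hx)
  have h2 : ∀ᵐ x ∂(volume.restrict (Set.Ioo a b)),
      |(Q x - P x) * ((m + 1) * Q x ^ m)| ≤ 2 * (m + 1) :=
    ae_restrict_of_forall_mem measurableSet_Ioo fun x hx => abs_gap_le m (hP1 x hx) (hQ1 x hx)
  filter_upwards [Lp.coeFn_add (Lp.bddMul (fun x => Q x ^ (m + 1)) (q - p))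
    (Lp.bddMul (fun x => (Q x - P x) * ((m + 1) * Q x ^ m)) q),
    Lp.coeFn_bddMul (hQ.pow (m + 1)) h1 (q - p),
    Lp.coeFn_bddMul ((hQ.sub hP).mul ((hQ.pow m).const_mul ((m : ℝ) + 1))) h2 q,
    Lp.coeFn_sub q p] with x e1 e2 e3 e4
  rw [gapDeriv, e1, Pi.add_apply]
  erw [e2, e3]
  rw [e4]
  rfl

namespace IsApprox

variable {p q : L2 a b} {P Q : ℝ → ℝ} {ξ η : ℕ → ℝ → ℝ} {g h : ℕ → L2 a b}

theorem coeFn_gapDeriv_approx (hp : IsApprox a b p P ξ g) (hq : IsApprox a b q Q η h) (m k : ℕ) :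
    gapDeriv m (ξ k) (η k) (g k) (h k) =ᵐ[volume.restrict (Set.Ioo a b)]
      deriv (fun x => (η k x - ξ k x) * η k x ^ (m + 1)) := by
  filter_upwards [coeFn_gapDeriv m (g k) (h k) (hp.test k).contDiff.continuous.aestronglyMeasurable
    (hq.test k).contDiff.continuous.aestronglyMeasurable
    (fun x _ => (hp.test k).abs_le_one x) (fun x _ => (hq.test k).abs_le_one x),
    hp.ae_eq_deriv k, hq.ae_eq_deriv k] with x e1 e2 e3
  have d1 := ((hp.test k).differentiableAt x).hasDerivAt
  have d2 := ((hq.test k).differentiableAt x).hasDerivAt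
  have := ((d2.sub d1).mul (d2.pow (m + 1))).deriv
  rw [e1, e2, e3]
  refine Eq.trans ?_ this.symm
  simp
  ring

theorem tendsto_gapDeriv (hp : IsApprox a b p P ξ g) (hq : IsApprox a b q Q η h) (m : ℕ)
    (w : L2 a b) : Tendsto (fun k => inner ℝ w (gapDeriv m (ξ k) (η k) (g k) (h k))) atTop
      (𝓝 (inner ℝ w (gapDeriv m P Q p q))) := by
  simp only [gapDeriv, inner_add_right]
  have cξ := fun k => (hp.test k).contDiff.continuous
  have cη := fun k => (hq.test k).contDiff.continuous
  refine Tendsto.add ?_ ?_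
  · refine Lp.tendsto_inner_bddMul (C := 1) w (hq.tendsto.sub hp.tendsto) ?_ ?_ ?_
    · exact fun k => ((cη k).pow _).aestronglyMeasurable
    · refine fun k => Eventually.of_forall fun x => ?_
      rw [abs_pow]
      exact pow_le_one₀ (abs_nonneg _) ((hq.test k).abs_le_one x)
    · exact ae_restrict_of_forall_mem measurableSet_Ioo fun x hx => (hq.tendsto_apply x hx).pow _
  · refine Lp.tendsto_inner_bddMul (C := 2 * (m + 1)) w hq.tendsto ?_ ?_ ?_
    · exact fun k => (((cη k).sub (cξ k)).mul
        (continuous_const.mul ((cη k).pow _))).aestronglyMeasurable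
    · exact fun k => Eventually.of_forall fun x =>
        abs_gap_le m ((hp.test k).abs_le_one x) ((hq.test k).abs_le_one x)
    · exact ae_restrict_of_forall_mem measurableSet_Ioo fun x hx =>
        ((hq.tendsto_apply x hx).sub (hp.tendsto_apply x hx)).mul
          (((hq.tendsto_apply x hx).pow _).const_mul _)

theorem contDiff_gap (hp : IsApprox a b p P ξ g) (hq : IsApprox a b q Q η h) (m k : ℕ) :
    ContDiff ℝ 1 (fun x => (η k x - ξ k x) * η k x ^ (m + 1)) :=
  ((hq.test k).contDiff.sub (hp.test k).contDiff).mul ((hq.test k).contDiff.pow _)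

/-- Moving from `P` towards `Q` by the factor `Q ^ (m + 1) ∈ [0, 1]` stays in the dual ball. -/
theorem inner_gapDeriv_nonpos (hp : IsApprox a b p P ξ g) (hq : IsApprox a b q Q η h) {m : ℕ}
    (hm : Even (m + 1)) {u : L2 a b} (hu : ∀ r ∈ dualBall a b, inner ℝ u (r - p) ≤ 0) :
    inner ℝ u (gapDeriv m P Q p q) ≤ 0 := by
  have hlim : Tendsto (fun k => inner ℝ u (g k + gapDeriv m (ξ k) (η k) (g k) (h k) - p)) atTop
      (𝓝 (inner ℝ u (gapDeriv m P Q p q))) := by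
    have h1 : Tendsto (fun k => inner ℝ u (g k - p)) atTop (𝓝 0) := by
      have := (tendsto_const_nhds (x := u)).inner (𝕜 := ℝ) (hp.tendsto.sub_const p)
      simpa using this
    have h2 := h1.add (hp.tendsto_gapDeriv hq m u)
    rw [zero_add] at h2
    refine h2.congr fun k => ?_
    rw [← inner_add_right]
    congr 1
    abel
  -- The competitor is built from the smooth approximants, where it is the derivative of a genuine
  -- test function; only the inequality passes to the limit.
  refine le_of_tendsto' hlim fun k => hu _ (subset_closure ?_)
  refine ⟨fun x => ξ k x + (η k x - ξ k x) * η k x ^ (m + 1),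
    (hp.test k).of_pair (hq.test k) ?_ (fun x => ?_) ?_, ?_⟩
  · exact (hp.test k).contDiff.add (hp.contDiff_gap hq m k)
  · have h1 := abs_le.1 ((hp.test k).abs_le_one x)
    have h2 := abs_le.1 ((hq.test k).abs_le_one x)
    have h3 : 0 ≤ η k x ^ (m + 1) := hm.pow_nonneg _
    have h4 : η k x ^ (m + 1) ≤ 1 := by
      rw [← hm.pow_abs]
      exact pow_le_one₀ (abs_nonneg _) ((hq.test k).abs_le_one x)
    rw [abs_le]
    constructor <;> nlinarith
  · intro x h1 h2
    simp [h1, h2]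
  · filter_upwards [hp.ae_eq_deriv k, hp.coeFn_gapDeriv_approx hq m k,
      Lp.coeFn_add (g k) (gapDeriv m (ξ k) (η k) (g k) (h k))] with x e1 e2 e3
    rw [e3, Pi.add_apply, e1, e2]
    exact (((hp.test k).differentiableAt x).hasDerivAt.add
      ((hp.contDiff_gap hq m k).differentiable one_ne_zero x).hasDerivAt).deriv.symm

/-- A small multiple of `(Q - P) (1 - Q ^ (m + 1))` may be added to `Q`. -/
theorem inner_sub_le_inner_gapDeriv (hp : IsApprox a b p P ξ g) (hq : IsApprox a b q Q η h)
    {m : ℕ} (hm : Even (m + 1)) {v : L2 a b}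
    (hv : ∀ r ∈ dualBall a b, inner ℝ v (r - q) ≤ 0) :
    inner ℝ v (q - p) ≤ inner ℝ v (gapDeriv m P Q p q) := by
  -- Chosen so that the perturbation is at most `1 - |η k x|`: the gap is bounded by 2, and
  -- Bernoulli gives `1 - η ^ (m + 1) ≤ (m + 1) (1 - |η|)`.
  set δ : ℝ := 1 / (2 * (m + 1)) with hδ
  have hδ0 : 0 < δ := by positivity
  have hδ1 : δ * (2 * (m + 1)) = 1 := by rw [hδ]; field_simp
  have hlim : Tendsto (fun k => inner ℝ v
      (h k + δ • (h k - g k - gapDeriv m (ξ k) (η k) (g k) (h k)) - q)) atTop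
      (𝓝 (δ * (inner ℝ v (q - p) - inner ℝ v (gapDeriv m P Q p q)))) := by
    have h1 : Tendsto (fun k => inner ℝ v (h k - q)) atTop (𝓝 0) := by
      have := (tendsto_const_nhds (x := v)).inner (𝕜 := ℝ) (hq.tendsto.sub_const q)
      simpa using this
    have h2 : Tendsto (fun k => inner ℝ v (h k - g k)) atTop (𝓝 (inner ℝ v (q - p))) :=
      tendsto_const_nhds.inner (hq.tendsto.sub hp.tendsto)
    have h3 := h1.add ((h2.sub (hp.tendsto_gapDeriv hq m v)).const_mul δ)
    rw [zero_add] at h3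
    refine h3.congr fun k => ?_
    rw [← inner_sub_right, ← real_inner_smul_right, ← inner_add_right]
    congr 1
    abel
  have key := le_of_tendsto' hlim (b := 0) fun k => hv _ (subset_closure ?_)
  · nlinarith
  refine ⟨fun x => η k x + δ * (η k x - ξ k x - (η k x - ξ k x) * η k x ^ (m + 1)),
    (hp.test k).of_pair (hq.test k) ?_ (fun x => ?_) ?_, ?_⟩
  · exact (hq.test k).contDiff.add (contDiff_const.mul
      (((hq.test k).contDiff.sub (hp.test k).contDiff).sub (hp.contDiff_gap hq m k)))
  · have h1 := (hp.test k).abs_le_one x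
    have h2 := (hq.test k).abs_le_one x
    have h3 : η k x ^ (m + 1) ≤ 1 := by
      rw [← hm.pow_abs]
      exact pow_le_one₀ (abs_nonneg _) h2
    have h4 : 1 - η k x ^ (m + 1) ≤ (m + 1) * (1 - |η k x|) := by
      have := one_add_mul_le_pow (a := |η k x| - 1) (by linarith [abs_nonneg (η k x)]) (m + 1)
      rw [add_sub_cancel, hm.pow_abs] at this
      push_cast at this
      linarith
    have h5 : |η k x - ξ k x| ≤ 2 := (abs_sub _ _).trans (by linarith)
    have e : η k x - ξ k x - (η k x - ξ k x) * η k x ^ (m + 1)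
        = (η k x - ξ k x) * (1 - η k x ^ (m + 1)) := by ring
    have h6 : |δ * ((η k x - ξ k x) * (1 - η k x ^ (m + 1)))| ≤ 1 - |η k x| := by
      rw [abs_mul, abs_mul, abs_of_pos hδ0, abs_of_nonneg (sub_nonneg.2 h3)]
      calc δ * (|η k x - ξ k x| * (1 - η k x ^ (m + 1)))
          ≤ δ * (2 * ((m + 1) * (1 - |η k x|))) := by gcongr
        _ = δ * (2 * (m + 1)) * (1 - |η k x|) := by ring
        _ = 1 - |η k x| := by rw [hδ1, one_mul]
    rw [e]
    exact (abs_add_le _ _).trans (by linarith)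
  · intro x h1 h2
    simp [h1, h2]
  · filter_upwards [hp.ae_eq_deriv k, hq.ae_eq_deriv k, hp.coeFn_gapDeriv_approx hq m k,
      Lp.coeFn_add (h k) (δ • (h k - g k - gapDeriv m (ξ k) (η k) (g k) (h k))),
      Lp.coeFn_smul δ (h k - g k - gapDeriv m (ξ k) (η k) (g k) (h k)),
      Lp.coeFn_sub (h k - g k) (gapDeriv m (ξ k) (η k) (g k) (h k)),
      Lp.coeFn_sub (h k) (g k)] with x e1 e2 e3 e4 e5 e6 e7
    rw [e4, Pi.add_apply, e5, Pi.smul_apply, e6, Pi.sub_apply, e7, Pi.sub_apply, e1, e2, e3]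
    have d1 := ((hp.test k).differentiableAt x).hasDerivAt
    have d2 := ((hq.test k).differentiableAt x).hasDerivAt
    have d3 := ((hp.contDiff_gap hq m k).differentiable one_ne_zero x).hasDerivAt
    exact (d2.add (((d2.sub d1).sub d3).const_mul δ)).deriv.symm

/-- By `P Q ^ m ≤ |Q| ^ m`, the integrand of `-⟨q, G⟩` lies below `F m`, which no longer involves
`P`. -/
theorem exists_bound_tendsto_zero (hp : IsApprox a b p P ξ g) (hq : IsApprox a b q Q η h) :
    ∃ B : ℕ → ℝ, Tendsto B atTop (𝓝 0) ∧
      ∀ m, Even (m + 1) → -inner ℝ q (gapDeriv m P Q p q) ≤ B m := by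
  let F : ℕ → ℝ → ℝ := fun m x =>
    q x * p x * |Q x| ^ (m + 1) + (m + 1) * (|Q x| ^ m * (1 - |Q x|)) * (q x * q x)
  have hqp : Integrable (fun x => q x * p x) (volume.restrict (Set.Ioo a b)) :=
    (Lp.memLp q).integrable_mul (Lp.memLp p)
  have hqq : Integrable (fun x => q x * q x) (volume.restrict (Set.Ioo a b)) :=
    (Lp.memLp q).integrable_mul (Lp.memLp q)
  have hQa : AEStronglyMeasurable (fun x => |Q x|) (volume.restrict (Set.Ioo a b)) :=
    hq.aestronglyMeasurable.norm
  have hFm : ∀ m, AEStronglyMeasurable (F m) (volume.restrict (Set.Ioo a b)) := fun m =>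
    (hqp.aestronglyMeasurable.mul (hQa.pow _)).add
      ((((hQa.pow m).mul (aestronglyMeasurable_const.sub hQa)).const_mul _).mul
        hqq.aestronglyMeasurable)
  -- This makes the domination uniform in `m`: `(m + 1) t ^ m` is at most the geometric sum, which
  -- `1 - t` telescopes.
  have hpow : ∀ (m : ℕ) (t : ℝ), 0 ≤ t → t ≤ 1 → ((m : ℝ) + 1) * (t ^ m * (1 - t)) ≤ 1 := by
    intro m t h0 h1
    have h2 : ((m : ℝ) + 1) * t ^ m ≤ ∑ i ∈ Finset.range (m + 1), t ^ i := by
      have : ∑ _i ∈ Finset.range (m + 1), t ^ m ≤ ∑ i ∈ Finset.range (m + 1), t ^ i :=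
        Finset.sum_le_sum fun i hi =>
          pow_le_pow_of_le_one h0 h1 (Nat.lt_succ_iff.1 (Finset.mem_range.1 hi))
      simpa using this
    have h3 := geom_sum_mul_neg t (m + 1)
    have h4 : 0 ≤ t ^ (m + 1) := by positivity
    nlinarith [mul_le_mul_of_nonneg_right h2 (sub_nonneg.2 h1)]
  have hFb : ∀ m, ∀ᵐ x ∂(volume.restrict (Set.Ioo a b)),
      ‖F m x‖ ≤ |q x * p x| + q x * q x := by
    intro m
    refine ae_restrict_of_forall_mem measurableSet_Ioo fun x hx => ?_
    have h1 := hq.abs_le_one hx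
    have h0 := abs_nonneg (Q x)
    refine (norm_add_le _ _).trans (add_le_add ?_ ?_)
    · rw [norm_mul, Real.norm_eq_abs, Real.norm_eq_abs, abs_of_nonneg (pow_nonneg h0 _)]
      exact mul_le_of_le_one_right (abs_nonneg _) (pow_le_one₀ h0 h1)
    · have h2 : 0 ≤ ((m : ℝ) + 1) * (|Q x| ^ m * (1 - |Q x|)) :=
        mul_nonneg (by positivity) (mul_nonneg (pow_nonneg h0 _) (sub_nonneg.2 h1))
      rw [Real.norm_eq_abs, abs_of_nonneg (mul_nonneg h2 (mul_self_nonneg _))]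
      exact mul_le_of_le_one_left (mul_self_nonneg _) (hpow m _ h0 h1)
  refine ⟨fun m => ∫ x in Set.Ioo a b, F m x, ?_, ?_⟩
  · have := tendsto_integral_of_dominated_convergence (f := fun _ => 0) _ hFm
      (hqp.abs.add hqq) hFb ?_
    · simpa using this
    filter_upwards [hq.ae_eq_zero, ae_restrict_mem measurableSet_Ioo] with x h0 hx
    -- Off the contact set the powers decay faster than `m + 1` grows; on it `q` vanishes.
    rcases (hq.abs_le_one hx).lt_or_eq with h1 | h1
    · have t1 := (tendsto_add_atTop_iff_nat 1).2
        (tendsto_pow_atTop_nhds_zero_of_lt_one (abs_nonneg (Q x)) h1)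
      have t2 := tendsto_self_mul_const_pow_of_lt_one (abs_nonneg (Q x)) h1
      have t3 := tendsto_pow_atTop_nhds_zero_of_lt_one (abs_nonneg (Q x)) h1
      have t4 := (t1.const_mul (q x * p x)).add
        (((t2.add t3).mul_const (1 - |Q x|)).mul_const (q x * q x))
      simp only [mul_zero, add_zero, zero_mul] at t4
      refine t4.congr fun m => ?_
      simp only [F]
      ring
    · simp [F, h0 h1]
  · intro m hm
    rw [← inner_neg_left, L2.inner_def]
    refine integral_mono_ae (L2.integrable_inner _ _) ((hqp.abs.add hqq).mono' (hFm m) (hFb m)) ?_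
    filter_upwards [Lp.coeFn_neg q, coeFn_gapDeriv m p q hp.aestronglyMeasurable
      hq.aestronglyMeasurable (fun x hx => hp.abs_le_one hx) (fun x hx => hq.abs_le_one hx),
      ae_restrict_mem measurableSet_Ioo] with x e1 e2 hx
    simp only [e1, e2, F, Pi.neg_apply, RCLike.inner_apply, conj_trivial, hm.pow_abs]
    have h1 : P x * Q x ^ m ≤ |Q x| ^ m := by
      refine (le_abs_self _).trans ?_
      rw [abs_mul, abs_pow]
      exact mul_le_of_le_one_left (by positivity) (hp.abs_le_one hx)
    have h2 : |Q x| ^ m * |Q x| = Q x ^ (m + 1) := by rw [← pow_succ, hm.pow_abs]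
    have h3 : 0 ≤ Q x ^ (m + 1) := hm.pow_nonneg _
    have h4 : ((m : ℝ) + 1) * (q x * q x) * (P x * Q x ^ m)
        ≤ ((m : ℝ) + 1) * (q x * q x) * |Q x| ^ m :=
      mul_le_mul_of_nonneg_left h1 (mul_nonneg (by positivity) (mul_self_nonneg _))
    have h5 : 0 ≤ q x * q x * Q x ^ (m + 1) := mul_nonneg (mul_self_nonneg _) h3
    have e3 : ((m : ℝ) + 1) * (|Q x| ^ m * (1 - |Q x|)) * (q x * q x)
        = (m + 1) * (q x * q x) * |Q x| ^ m - (m + 1) * (q x * q x) * Q x ^ (m + 1) := by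
      rw [← h2]; ring
    rw [e3]
    have e4 : (Q x ^ (m + 1) * (q x - p x) + (Q x - P x) * ((m + 1) * Q x ^ m) * q x) * -q x
        = q x * p x * Q x ^ (m + 1) - q x * q x * Q x ^ (m + 1)
          + ((m + 1) * (q x * q x) * (P x * Q x ^ m)
            - (m + 1) * (q x * q x) * Q x ^ (m + 1)) := by ring
    rw [e4]
    linarith

end IsApprox

/-! ### The semigroup property -/

/-- If `p` is a subgradient of `J` at `v + mu q`, where `q` is a subgradient at `v`, then `p` is
also a subgradient at `v`. -/
theorem inner_sub_nonpos_of_isMax {p q v : L2 a b} {mu : ℝ} (hmu : 0 ≤ mu)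
    (hp : p ∈ dualBall a b) (hq : q ∈ dualBall a b)
    (hu : ∀ r ∈ dualBall a b, inner ℝ (v + mu • q) (r - p) ≤ 0)
    (hv : ∀ r ∈ dualBall a b, inner ℝ v (r - q) ≤ 0) : inner ℝ v (q - p) ≤ 0 := by
  obtain ⟨ξ, g, hP⟩ := exists_isApprox hp
  obtain ⟨η, h, hQ⟩ := exists_isApprox hq
  obtain ⟨B, hB, hle⟩ := hP.exists_bound_tendsto_zero hQ
  -- Only odd `m` are used, so that `Q ^ (m + 1)` is nonnegative.
  have hodd : Tendsto (fun n : ℕ => 2 * n + 1) atTop atTop :=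
    tendsto_atTop_mono (fun n => by simp only [id]; omega) tendsto_id
  have hlim := (hB.comp hodd).const_mul mu
  rw [mul_zero] at hlim
  refine ge_of_tendsto' hlim fun n => ?_
  have hm : Even (2 * n + 1 + 1) := ⟨n + 1, by ring⟩
  have h1 := hP.inner_sub_le_inner_gapDeriv hQ hm hv
  have h2 := hP.inner_gapDeriv_nonpos hQ hm hu
  have h3 := mul_le_mul_of_nonneg_left (hle _ hm) hmu
  rw [inner_add_left, real_inner_smul_left] at h2
  simp only [Function.comp_apply]
  linarith

theorem denoise_denoise {lam mu : ℝ} (hlam : 0 < lam) (hmu : 0 < mu) (f : L2 a b) :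
    denoise a b mu (denoise a b lam f) = denoise a b (lam + mu) f := by
  obtain ⟨p, hp, hu, hf⟩ := exists_moreau hlam f
  obtain ⟨q, hq, hv, hf'⟩ := exists_moreau hmu (denoise a b lam f)
  set u := denoise a b lam f
  set v := denoise a b mu u
  rw [hf'] at hu
  have hqp := inner_sub_nonpos_of_isMax hmu.le hp hq hu hv
  have hs : 0 < lam + mu := add_pos hlam hmu
  -- The weights are forced by `lam • p + mu • q = (lam + mu) • (mean)`.
  have hmem : (lam / (lam + mu)) • p + (mu / (lam + mu)) • q ∈ dualBall a b :=
    convex_dualBall hp hq (by positivity) (by positivity) (by field_simp)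
  refine (denoise_eq_of_isMax hs hmem (fun r hr => ?_) ?_).symm
  · have e : r - ((lam / (lam + mu)) • p + (mu / (lam + mu)) • q)
        = (r - q) + (lam / (lam + mu)) • (q - p) := by
      have : mu / (lam + mu) = 1 - lam / (lam + mu) := by field_simp; ring
      rw [this]
      module
    rw [e, inner_add_right, real_inner_smul_right]
    exact add_nonpos (hv r hr) (mul_nonpos_of_nonneg_of_nonpos (by positivity) hqp)
  · rw [smul_add, smul_smul, smul_smul, mul_div_cancel₀ _ hs.ne', mul_div_cancel₀ _ hs.ne', hf]
    nth_rewrite 1 [hf']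
    abel

end ROF

theorem mainTheorem5 (a b : ℝ) (hab : a < b) (f : ROF.L2 a b) :
    (∀ lam : ℝ, 0 < lam →
      ROF.IsMinimizer a b lam f (ROF.denoise a b lam f) ∧
      ∀ v : ROF.L2 a b, ROF.IsMinimizer a b lam f v → v = ROF.denoise a b lam f) ∧
    (∀ lam mu : ℝ, 0 ≤ lam → 0 ≤ mu →
      ROF.denoise a b mu (ROF.denoise a b lam f) = ROF.denoise a b (lam + mu) f) := by
  refine ⟨fun lam hlam => ?_, fun lam mu hlam hmu => ?_⟩
  · obtain ⟨p, hp, hu, hf⟩ := ROF.exists_moreau hlam f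
    exact ⟨ROF.isMinimizer_of_isMax hlam.le hp hu hf,
      fun v hv => hv.eq_of_isMax hlam.le hp hu hf⟩
  · rcases hlam.eq_or_lt with rfl | hlam
    · simp [ROF.denoise]
    rcases hmu.eq_or_lt with rfl | hmu
    · simp [ROF.denoise]
    exact ROF.denoise_denoise hlam hmu f
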